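/- Let $(X,d)$ be a compact metric space with at least two points and let $f_{1,\infty}=(f_n)_{n\ge 1}$ be a sequence of continuous maps $f_n:X\to X$. For $i\ge 1$, $n\ge 1$ write $f_i^n=f_{i+n-1}\circ\cdots\circ f_{i+1}\circ f_i$, and $f_i^0=\mathrm{id}_X$. Let $f:X\to X$ be continuous, with iterates $f^k$. Assume: 1. (minimality) for every $x\in X$ the orbit $\{f_1^n(x): n\ge 0\}$ is dense in $X$; 2. (feeble openness) $\operatorname{int} f_i(U)\ne\emptyset$ for every $i\ge1$ and every nonempty open $U\subseteq X$; 3. every $f_i$ is surjective; 4. $f_n\to f$ uniformly on $X$; 5. (collective convergence) for every $\varepsilon>0$ there is $r_0$ such that $\sup_{x\in X}d(f_r^k(x),f^k(x))<\varepsilon$ for all $r\ge r_0$ and all $k\ge 1$; 6. (multi-transitivity) for every $m\ge1$ the product system $f_{1,\infty}\times f_{1,\infty}^{[2]}\times\cdots\times f_{1,\infty}^{[m]}$ on $X^m$ is topologically transitive, where $f_{1,\infty}^{[k]}=(f_{k(n-1)+1}^k)_{n\ge1}$, and a system $g_{1,\infty}$ on a space $Y$ is topologically transitive if for all nonempty open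 $U,V\subseteq Y$ there is $n\ge1$ with $g_1^n(U)\cap V\ne\emptyset$. (Equivalently: for all $m\ge 1$ and all nonempty open $U_1,\dots,U_m,V_1,\dots,V_m\subseteq X$ there is $l\ge1$ with $f_1^{jl}(U_j)\cap V_j\neq\emptyset$ for $j=1,\dots,m$.) Then $(X,f_{1,\infty})$ is Li–Yorke chaotic: there is an uncountable set $S\subseteq X$ such that for all distinct $x,y\in S$ $$\liminf_{n\to\infty}d(f_1^n(x),f_1^n(y))=0\quad\text{and}\quad\limsup_{n\to\infty}d(f_1^n(x),f_1^n(y))>0 .$$ -/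

import Mathlib

/-- A non-autonomous discrete system on `X`: a sequence of continuous self-maps
`f_1, f_2, f_3, …`. The entry `F n` with `n : ℕ` (starting at `0`) is the map `f_{n+1}`. -/
abbrev NDS (X : Type*) [TopologicalSpace X] := ℕ → C(X, X)

namespace NDS

section Topological

variable {X : Type*} [TopologicalSpace X]

/-- `comp F i n` is the composition `f_{i+1}^n = f_{i+n} ∘ ⋯ ∘ f_{i+1}` of `n` consecutive maps;
in particular `comp F 0 n` is `f_1^n`, and `comp F i 0` is the identity. -/
def comp (F : NDS X) (i : ℕ) : ℕ → C(X, X)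
  | 0 => ContinuousMap.id X
  | n + 1 => (F (i + n)).comp (comp F i n)

/-- The autonomous system `(X, f)`, i.e. the constant sequence `f, f, f, …`. Thus
`comp (autonomous f) 0 k` is the `k`-fold iterate of `f`. -/
def autonomous (f : C(X, X)) : NDS X := fun _ => f

/-- The orbit `{x, f_1^1(x), f_1^2(x), …}` of `x`. -/
def orbit (F : NDS X) (x : X) : Set X := Set.range fun n : ℕ => comp F 0 n x

/-- Minimality: every point has a dense orbit. -/
def IsMinimal (F : NDS X) : Prop := ∀ x : X, Dense (orbit F x)

/-- Feeble openness: every map of the sequence sends nonempty open sets to sets with nonempty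
interior. -/
def IsFeeblyOpen (F : NDS X) : Prop :=
  ∀ (i : ℕ) (U : Set X), IsOpen U → U.Nonempty → (interior (F i '' U)).Nonempty

/-- Topological transitivity: for nonempty open `U`, `V` some `f_1^n`, `n ≥ 1`, sends a point
of `U` into `V`. -/
def IsTransitive (F : NDS X) : Prop :=
  ∀ U V : Set X, IsOpen U → IsOpen V → U.Nonempty → V.Nonempty →
    ∃ n : ℕ, 1 ≤ n ∧ ((comp F 0 n '' U) ∩ V).Nonempty

/-- The `k`-th iterate `f_{1,∞}^{[k]} = (f_{k(n-1)+1}^k)_{n ≥ 1}`. -/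
def iterateSystem (F : NDS X) (k : ℕ) : NDS X := fun n => comp F (k * n) k

/-- The product of `m` systems on `X`, acting coordinatewise on `X^m`. -/
def prodSystem {m : ℕ} (G : Fin m → NDS X) : NDS (Fin m → X) := fun n =>
  ContinuousMap.pi fun j => (G j n).comp (ContinuousMap.eval j)

/-- Multi-transitivity: for every `m ≥ 1` the system
`f_{1,∞} × f_{1,∞}^{[2]} × ⋯ × f_{1,∞}^{[m]}` on `X^m` is transitive. -/
def IsMultiTransitive (F : NDS X) : Prop :=
  ∀ m : ℕ, 1 ≤ m → IsTransitive (prodSystem fun j : Fin m => iterateSystem F (j.val + 1))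

end Topological

section Metric

variable {X : Type*} [MetricSpace X] [CompactSpace X]

/-- Collective convergence of `(f_r^k)_k` to `(f^k)_k`: for large `r` the maps `f_r^k` and `f^k`
are `ε`-close for the supremum metric, for all `k ≥ 1` simultaneously. (The distance on `C(X, X)`
for compact `X` is the supremum metric.) -/
def ConvergesCollectively (F : NDS X) (f : C(X, X)) : Prop :=
  ∀ ε : ℝ, 0 < ε → ∃ r₀ : ℕ, ∀ r : ℕ, r₀ ≤ r → ∀ k : ℕ, 1 ≤ k →
    dist (comp F r k) (comp (autonomous f) 0 k) < ε

/-- Li–Yorke chaos: there is an uncountable set any two distinct points of which are proximal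
but not asymptotic. (By compactness the distances are bounded.) -/
def IsLiYorkeChaotic (F : NDS X) : Prop :=
  ∃ S : Set X, ¬ S.Countable ∧ ∀ x ∈ S, ∀ y ∈ S, x ≠ y →
    Filter.liminf (fun n : ℕ => dist (comp F 0 n x) (comp F 0 n y)) Filter.atTop = 0 ∧
    0 < Filter.limsup (fun n : ℕ => dist (comp F 0 n x) (comp F 0 n y)) Filter.atTop

end Metric

end NDS

open Filter Topology Set

namespace NDS

/-! ### Compositions along the sequence and hitting times. -/

section Topological

variable {X : Type*} [TopologicalSpace X]

/-! Collective convergence lets the tail of every orbit be shadowed by the limit map `f`, so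
minimality passes to `f`, and multi-transitivity then makes `f` weakly mixing (`weakMixing_limit`).
By feeble openness two open sets still contain open sets after many steps, from where `f` steers
both at once near any pair of points (`exists_pair_near`). Steering to (a, a) and to (a, b) shows
that the proximal pairs and the pairs separated infinitely often by a fixed δ each contain a dense
Gδ subset of X × X. As X has no isolated points (`nhdsNE_neBot`), a Mycielski-type argument
(`exists_uncountable_pairwise`) yields the scrambled set. -/

theorem comp_succ_apply (F : NDS X) (i n : ℕ) (x : X) :
    comp F i (n + 1) x = F (i + n) (comp F i n x) := rfl

theorem comp_add_apply (F : NDS X) (i a b : ℕ) (x : X) :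
    comp F i (a + b) x = comp F (i + a) b (comp F i a x) := by
  induction b with
  | zero => rfl
  | succ b ih => rw [← add_assoc, comp_succ_apply, comp_succ_apply, ih, add_assoc]

theorem comp_autonomous (f : C(X, X)) (i n : ℕ) :
    comp (autonomous f) i n = comp (autonomous f) 0 n := by
  ext x
  induction n with
  | zero => rfl
  | succ n ih => rw [comp_succ_apply, comp_succ_apply, ih]; rfl

theorem comp_autonomous_add_apply (f : C(X, X)) (a b : ℕ) (x : X) :
    comp (autonomous f) 0 (a + b) x =
      comp (autonomous f) 0 b (comp (autonomous f) 0 a x) := by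
  rw [comp_add_apply, comp_autonomous]

theorem comp_surjective {F : NDS X} (hF : ∀ n, Function.Surjective (F n)) (i n : ℕ) :
    Function.Surjective (comp F i n) := by
  induction n with
  | zero => exact Function.surjective_id
  | succ n ih => exact (hF (i + n)).comp ih

theorem IsFeeblyOpen.comp {F : NDS X} (hF : IsFeeblyOpen F) (i n : ℕ) {U : Set X}
    (hU : IsOpen U) (hne : U.Nonempty) : (interior (comp F i n '' U)).Nonempty := by
  induction n with
  | zero =>
    have : NDS.comp F i 0 '' U = U := image_id U
    rwa [this, hU.interior_eq]
  | succ n ih =>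
    refine (hF (i + n) _ isOpen_interior ih).mono (interior_mono ?_)
    rintro _ ⟨y, hy, rfl⟩
    obtain ⟨x, hx, rfl⟩ := interior_subset hy
    exact ⟨x, hx, rfl⟩

theorem comp_iterateSystem_apply (F : NDS X) (k n : ℕ) (x : X) :
    comp (iterateSystem F k) 0 n x = comp F 0 (k * n) x := by
  induction n with
  | zero => rfl
  | succ n ih =>
    rw [comp_succ_apply, ih, mul_add, mul_one, comp_add_apply, zero_add, zero_add]
    rfl

theorem comp_prodSystem_apply {m : ℕ} (G : Fin m → NDS X) (n : ℕ) (x : Fin m → X) (j : Fin m) :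
    comp (prodSystem G) 0 n x j = comp (G j) 0 n (x j) := by
  induction n with
  | zero => rfl
  | succ n ih => rw [comp_succ_apply, comp_succ_apply, ← ih]; rfl

/-- Multi-transitivity with one source and one target for all iterates. -/
theorem IsMultiTransitive.exists_forall {F : NDS X} (hF : IsMultiTransitive F) (m : ℕ)
    {U V : Set X} (hU : IsOpen U) (hV : IsOpen V) (hUne : U.Nonempty) (hVne : V.Nonempty) :
    ∃ l, 1 ≤ l ∧ ∀ j, 1 ≤ j → j ≤ m → ∃ x ∈ U, comp F 0 (j * l) x ∈ V := by
  rcases Nat.eq_zero_or_pos m with rfl | hm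
  · exact ⟨1, le_rfl, fun j h1 h2 => by omega⟩
  obtain ⟨u, hu⟩ := hUne
  obtain ⟨v, hv⟩ := hVne
  obtain ⟨l, hl, _, ⟨x, hx, rfl⟩, hy⟩ := hF m hm (univ.pi fun _ => U) (univ.pi fun _ => V)
    (isOpen_set_pi finite_univ fun _ _ => hU) (isOpen_set_pi finite_univ fun _ _ => hV)
    ⟨fun _ => u, fun _ _ => hu⟩ ⟨fun _ => v, fun _ _ => hv⟩
  refine ⟨l, hl, fun j h1 h2 => ⟨x ⟨j - 1, by omega⟩, hx _ trivial, ?_⟩⟩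
  have := hy ⟨j - 1, by omega⟩ trivial
  simp only [comp_prodSystem_apply, comp_iterateSystem_apply] at this
  rwa [Nat.sub_add_cancel h1] at this

/-- The (N + 1)-th iterate hits at time (N + 1) * l, which exceeds N. -/
theorem IsMultiTransitive.exists_ge {F : NDS X} (hF : IsMultiTransitive F) (N : ℕ)
    {U V : Set X} (hU : IsOpen U) (hV : IsOpen V) (hUne : U.Nonempty) (hVne : V.Nonempty) :
    ∃ n, N ≤ n ∧ ∃ x ∈ U, comp F 0 n x ∈ V := by
  obtain ⟨l, hl, h⟩ := hF.exists_forall (N + 1) hU hV hUne hVne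
  exact ⟨(N + 1) * l, by nlinarith, h (N + 1) (by omega) le_rfl⟩

theorem comp_autonomous_mul_apply {f : C(X, X)} {k : ℕ} {x : X}
    (hx : comp (autonomous f) 0 k x = x) (n : ℕ) : comp (autonomous f) 0 (k * n) x = x := by
  induction n with
  | zero => rfl
  | succ n ih => rw [mul_add, mul_one, comp_autonomous_add_apply, ih, hx]

end Topological

/-! ### Dynamics of the limit map. -/

section Metric

variable {X : Type*} [MetricSpace X] [CompactSpace X]

theorem ConvergesCollectively.dist_apply_lt {F : NDS X} {f : C(X, X)}
    (h : ConvergesCollectively F f) {ε : ℝ} (hε : 0 < ε) :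
    ∃ r₀, ∀ r, r₀ ≤ r → ∀ k, 1 ≤ k → ∀ x,
      dist (comp F r k x) (comp (autonomous f) 0 k x) < ε := by
  obtain ⟨r₀, hr₀⟩ := h ε hε
  exact ⟨r₀, fun r hr k hk x => (ContinuousMap.dist_apply_le_dist x).trans_lt (hr₀ r hr k hk)⟩

/-- A multi-transitive collectively convergent system on a nontrivial space has a perfect
phase space. -/
theorem IsMultiTransitive.nhdsNE_neBot [Nontrivial X] {F : NDS X} {f : C(X, X)}
    (hF : IsMultiTransitive F) (hcoll : ConvergesCollectively F f) (x : X) :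
    (𝓝[≠] x).NeBot := by
  refine ⟨fun hbot => ?_⟩
  have hx : IsOpen ({x} : Set X) := isOpen_singleton_iff_punctured_nhds x |>.2 hbot
  obtain ⟨δ, hδ, hball⟩ := Metric.isOpen_singleton_iff.1 hx
  obtain ⟨a, b, hab⟩ := exists_pair_ne X
  have hab' := dist_pos.2 hab
  obtain ⟨ε, hε, hεδ, hεab⟩ : ∃ ε : ℝ, 0 < ε ∧ ε ≤ δ ∧ 4 * ε ≤ dist a b :=
    ⟨min δ (dist a b / 4), lt_min hδ (by linarith), min_le_left _ _,
      by linarith [min_le_right δ (dist a b / 4)]⟩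
  obtain ⟨r₀, hr₀⟩ := hcoll.dist_apply_lt hε
  obtain ⟨r, hr, _, rfl, hrx⟩ := hF.exists_ge r₀ hx hx ⟨x, rfl⟩ ⟨x, rfl⟩
  rename_i x
  rw [mem_singleton_iff] at hrx
  obtain ⟨s, hs, y, hy, hsx⟩ := hF.exists_ge (r + 1) hx hx ⟨x, rfl⟩ ⟨x, rfl⟩
  obtain rfl : y = x := hy
  obtain ⟨k, rfl⟩ := Nat.exists_eq_add_of_le hs
  rw [mem_singleton_iff, add_assoc, comp_add_apply, hrx, zero_add] at hsx
  -- Two late returns to the isolated point make it periodic under `f`.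
  have hper : comp (autonomous f) 0 (1 + k) y = y := by
    have := hr₀ r hr (1 + k) (by omega) y
    rw [hsx, dist_comm] at this
    exact hball _ (this.trans_le hεδ)
  -- At times divisible by the period, the `f`-steps left after time r are ≡ -r modulo it, so all
  -- such orbit points lie near one point; multi-transitivity puts some near any c.
  have key : ∀ c : X, dist c (comp (autonomous f) 0 ((1 + k) * r - r) y) < 2 * ε := by
    intro c
    obtain ⟨l, hl, h⟩ := hF.exists_forall ((1 + k) * (r + 1)) hx
      (Metric.isOpen_ball (x := c) (ε := ε)) ⟨y, rfl⟩ ⟨c, Metric.mem_ball_self hε⟩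
    obtain ⟨z, hz, hzc⟩ := h _ (by nlinarith) le_rfl
    obtain rfl : z = y := hz
    have hle : r ≤ (1 + k) * r := by nlinarith
    have hle' : r + 1 ≤ (r + 1) * l := by nlinarith
    obtain ⟨t, ht⟩ := Nat.exists_eq_add_of_le hle'
    have e : (1 + k) * (r + 1) * l
        = r + ((1 + k) * (1 + t) + ((1 + k) * r - r)) := by
      rw [mul_assoc, ht]
      zify [hle]
      ring
    rw [e, comp_add_apply, hrx, zero_add, Metric.mem_ball] at hzc
    have h1 := hr₀ r hr ((1 + k) * (1 + t) + ((1 + k) * r - r)) (by nlinarith) z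
    rw [comp_autonomous_add_apply, comp_autonomous_mul_apply hper] at h1
    linarith [dist_triangle_left c (comp (autonomous f) 0 ((1 + k) * r - r) z)
      (comp F r ((1 + k) * (1 + t) + ((1 + k) * r - r)) z)]
  linarith [key a, key b, dist_triangle_right a b (comp (autonomous f) 0 ((1 + k) * r - r) y)]

/-- Every orbit of the limit map of a minimal system visits every open set infinitely often. -/
theorem IsMinimal.exists_ge_limit [∀ x : X, (𝓝[≠] x).NeBot] {F : NDS X} {f : C(X, X)}
    (hF : IsMinimal F) (hsurj : ∀ n, Function.Surjective (F n))
    (hcoll : ConvergesCollectively F f) (N : ℕ) (z : X) {V : Set X} (hV : IsOpen V)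
    (hne : V.Nonempty) : ∃ n, N ≤ n ∧ comp (autonomous f) 0 n z ∈ V := by
  obtain ⟨v, hv⟩ := hne
  obtain ⟨ε, hε, hball⟩ := Metric.isOpen_iff.1 hV v hv
  obtain ⟨r, hr⟩ := hcoll.dist_apply_lt (half_pos hε)
  obtain ⟨w, rfl⟩ := comp_surjective hsurj 0 r z
  -- Without isolated points, an orbit stays dense after its initial segment is removed.
  have hfin : ((fun n => comp F 0 n w) '' Iic (r + N)).Finite := (finite_Iic _).image _
  obtain ⟨_, hmem, ⟨n, rfl⟩, hn⟩ := ((hF w).sdiff_finite hfin).exists_mem_open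
    (Metric.isOpen_ball (x := v) (ε := ε / 2)) ⟨v, Metric.mem_ball_self (half_pos hε)⟩ |>.imp
      fun _ h => And.intro h.2 h.1
  have hlt : r + N < n := not_le.1 fun h => hn ⟨n, h, rfl⟩
  obtain ⟨k, rfl⟩ := Nat.exists_eq_add_of_le (show r ≤ n by omega)
  simp only [comp_add_apply, zero_add, Metric.mem_ball] at hmem
  refine ⟨k, by omega, hball ?_⟩
  have := hr r le_rfl k (by omega) (comp F 0 r w)
  rw [Metric.mem_ball]
  linarith [dist_triangle_left (comp (autonomous f) 0 k (comp F 0 r w)) v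
    (comp F r k (comp F 0 r w))]

/-- The limit map of a minimal multi-transitive system is weakly mixing. -/
theorem IsMultiTransitive.weakMixing_limit [∀ x : X, (𝓝[≠] x).NeBot] {F : NDS X} {f : C(X, X)}
    (hF : IsMultiTransitive F) (hmin : IsMinimal F) (hsurj : ∀ n, Function.Surjective (F n))
    (hcoll : ConvergesCollectively F f) {U₁ V₁ U₂ V₂ : Set X} (hU₁ : IsOpen U₁)
    (hV₁ : IsOpen V₁) (hU₂ : IsOpen U₂) (hV₂ : IsOpen V₂) (nU₁ : U₁.Nonempty)
    (nV₁ : V₁.Nonempty) (nU₂ : U₂.Nonempty) (nV₂ : V₂.Nonempty) :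
    ∃ k, 1 ≤ k ∧ (∃ x ∈ U₁, comp (autonomous f) 0 k x ∈ V₁) ∧
      ∃ x ∈ U₂, comp (autonomous f) 0 k x ∈ V₂ := by
  obtain ⟨v, hv⟩ := nV₂
  obtain ⟨ε, hε, hball⟩ := Metric.isOpen_iff.1 hV₂ v hv
  obtain ⟨r₀, hr₀⟩ := hcoll.dist_apply_lt (half_pos hε)
  obtain ⟨a, ha⟩ := nV₁
  obtain ⟨r, hr, har⟩ := hmin.exists_ge_limit hsurj hcoll r₀ a hU₁ nU₁
  -- If y and `f^q y` lie in A with q > r, then `f^r y` goes from U₁ to V₁ in q - r steps.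
  set A : Set X := V₁ ∩ comp (autonomous f) 0 r ⁻¹' U₁
  have hA : IsOpen A := hV₁.inter (hU₁.preimage (map_continuous _))
  obtain ⟨T, hT⟩ := isCompact_univ.elim_finite_subcover
    (fun i => comp (autonomous f) 0 i ⁻¹' A) (fun i => hA.preimage (map_continuous _))
    (fun x _ => by
      obtain ⟨n, -, hn⟩ := hmin.exists_ge_limit hsurj hcoll 0 x hA ⟨a, ha, har⟩
      exact mem_iUnion.2 ⟨n, hn⟩)
  -- The factor r + 1 forces the chosen multiple of l past r.
  obtain ⟨l, hl, h⟩ := hF.exists_forall (T.card * (r + 1))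
    (hU₂.preimage (map_continuous (comp F 0 r))) (Metric.isOpen_ball (x := v) (ε := ε / 2))
    (nU₂.preimage (comp_surjective hsurj 0 r)) ⟨v, Metric.mem_ball_self (half_pos hε)⟩
  have hcol : ∀ j : ℕ, ∃ i ∈ T, comp (autonomous f) 0 (j * ((r + 1) * l) + i) a ∈ A := by
    intro j
    have := hT (mem_univ (comp (autonomous f) 0 (j * ((r + 1) * l)) a))
    simp only [mem_iUnion, mem_preimage] at this
    obtain ⟨i, hi, hmem⟩ := this
    exact ⟨i, hi, by rwa [comp_autonomous_add_apply]⟩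
  choose c hcT hcA using hcol
  -- Equal delays make (j' - j) * (r + 1) * l a return time to A; being a multiple of l, it also
  -- serves U₂ and V₂.
  obtain ⟨j, hj, j', hj', hne, heq⟩ := Finset.exists_ne_map_eq_of_card_lt_of_maps_to
    (s := Finset.range (T.card + 1)) (t := T) (by simp) (f := c) (fun j _ => hcT j)
  wlog hlt : j < j' generalizing j j'
  · exact this j' hj' j hj hne.symm heq.symm (by omega)
  rw [Finset.mem_range] at hj hj'
  obtain ⟨d, rfl⟩ := Nat.exists_eq_add_of_lt hlt
  obtain ⟨w, hw, hwv⟩ := h ((d + 1) * (r + 1)) (by nlinarith) (Nat.mul_le_mul_right _ (by omega))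
  have hle : r + 1 ≤ (d + 1) * (r + 1) * l := by
    calc r + 1 = 1 * (r + 1) * 1 := by ring
      _ ≤ _ := by gcongr; omega
  obtain ⟨k, hk⟩ := Nat.exists_eq_add_of_le hle
  have hq := hcA (j + d + 1)
  rw [← heq, show (j + d + 1) * ((r + 1) * l) + c j
    = (j * ((r + 1) * l) + c j) + (d + 1) * (r + 1) * l by ring, comp_autonomous_add_apply, hk,
    add_assoc, comp_autonomous_add_apply] at hq
  refine ⟨1 + k, by omega, ⟨_, (hcA j).2, hq.1⟩, comp F 0 r w, hw, hball ?_⟩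
  rw [hk, add_assoc, comp_add_apply, zero_add, Metric.mem_ball] at hwv
  rw [Metric.mem_ball]
  linarith [dist_triangle_left (comp (autonomous f) 0 (1 + k) (comp F 0 r w)) v
    (comp F r (1 + k) (comp F 0 r w)), hr₀ r hr (1 + k) (by omega) (comp F 0 r w)]

/-- Up to an arbitrarily small error, a pair of open sets can be steered simultaneously to any
pair of points, at arbitrarily late times. -/
theorem IsMultiTransitive.exists_pair_near [∀ x : X, (𝓝[≠] x).NeBot] {F : NDS X} {f : C(X, X)}
    (hF : IsMultiTransitive F) (hmin : IsMinimal F) (hopen : IsFeeblyOpen F)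
    (hsurj : ∀ n, Function.Surjective (F n)) (hcoll : ConvergesCollectively F f)
    {U V : Set X} (hU : IsOpen U) (hV : IsOpen V) (nU : U.Nonempty) (nV : V.Nonempty) (a b : X)
    {ε : ℝ} (hε : 0 < ε) (N : ℕ) :
    ∃ n, N ≤ n ∧ ∃ x ∈ U, ∃ y ∈ V, dist (comp F 0 n x) a < ε ∧ dist (comp F 0 n y) b < ε := by
  obtain ⟨r₀, hr₀⟩ := hcoll.dist_apply_lt (half_pos hε)
  obtain ⟨k, hk, ⟨u, hu, hua⟩, v, hv, hvb⟩ := hF.weakMixing_limit hmin hsurj hcoll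
    isOpen_interior (Metric.isOpen_ball (x := a) (ε := ε / 2))
    isOpen_interior (Metric.isOpen_ball (x := b) (ε := ε / 2))
    (hopen.comp 0 (r₀ + N) hU nU) ⟨a, Metric.mem_ball_self (half_pos hε)⟩
    (hopen.comp 0 (r₀ + N) hV nV) ⟨b, Metric.mem_ball_self (half_pos hε)⟩
  obtain ⟨x, hx, rfl⟩ := interior_subset hu
  obtain ⟨y, hy, rfl⟩ := interior_subset hv
  rw [Metric.mem_ball] at hua hvb
  refine ⟨r₀ + N + k, by omega, x, hx, y, hy, ?_, ?_⟩ <;> rw [comp_add_apply, zero_add]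
  · linarith [dist_triangle (comp F (r₀ + N) k (comp F 0 (r₀ + N) x))
        (comp (autonomous f) 0 k (comp F 0 (r₀ + N) x)) a,
      hr₀ (r₀ + N) (by omega) k hk (comp F 0 (r₀ + N) x)]
  · linarith [dist_triangle (comp F (r₀ + N) k (comp F 0 (r₀ + N) y))
        (comp (autonomous f) 0 k (comp F 0 (r₀ + N) y)) b,
      hr₀ (r₀ + N) (by omega) k hk (comp F 0 (r₀ + N) y)]

end Metric

end NDS

/-! ### Baire category and scrambled sets. -/

section Residual

variable {X : Type*} [TopologicalSpace X]

/-- The easy half of the Kuratowski–Ulam theorem for dense open sets. -/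
theorem Dense.residual_forall_dense_slice [SecondCountableTopology X] {O : Set (X × X)}
    (hd : Dense O) (ho : IsOpen O) : ∀ᶠ x in residual X, Dense {y | (x, y) ∈ O} := by
  have hB := TopologicalSpace.isBasis_countableBasis X
  have h : ∀ᶠ x in residual X, ∀ B ∈ TopologicalSpace.countableBasis X, ∃ y ∈ B, (x, y) ∈ O := by
    rw [eventually_countable_ball (TopologicalSpace.countable_countableBasis X)]
    intro B hBmem
    refine residual_of_dense_open ?_ ?_
    · have : {x | ∃ y ∈ B, (x, y) ∈ O} = Prod.fst '' (O ∩ Prod.snd ⁻¹' B) := by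
        ext x
        simp [and_comm]
      change IsOpen {x | ∃ y ∈ B, (x, y) ∈ O}
      rw [this]
      exact isOpenMap_fst _ (ho.inter ((hB.isOpen hBmem).preimage continuous_snd))
    · refine dense_iff_inter_open.2 fun U hU nU => ?_
      obtain ⟨⟨x, y⟩, ⟨hx, hy⟩, hxy⟩ := hd.inter_open_nonempty (U ×ˢ B)
        (hU.prod (hB.isOpen hBmem))
        (nU.prod (TopologicalSpace.nonempty_of_mem_countableBasis hBmem))
      exact ⟨x, hx, y, hy, hxy⟩
  filter_upwards [h] with x hx
  refine dense_iff_inter_open.2 fun U hU ⟨u, hu⟩ => ?_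
  obtain ⟨B, hBmem, -, hBU⟩ := hB.exists_subset_of_mem_open hu hU
  obtain ⟨y, hy, hxy⟩ := hx B hBmem
  exact ⟨y, hBU hy, hxy⟩

/-- A symmetric relation containing a dense Gδ set of pairs, on a perfect second countable Baire
space, holds between all distinct points of some uncountable set. -/
theorem exists_uncountable_pairwise [SecondCountableTopology X] [BaireSpace X] [T1Space X]
    [Nonempty X] [∀ x : X, (𝓝[≠] x).NeBot] {O : ℕ → Set (X × X)} (ho : ∀ n, IsOpen (O n))
    (hd : ∀ n, Dense (O n)) (hsymm : ∀ n x y, (x, y) ∈ O n → (y, x) ∈ O n) :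
    ∃ S : Set X, ¬ S.Countable ∧ ∀ x ∈ S, ∀ y ∈ S, x ≠ y → ∀ n, (x, y) ∈ O n := by
  have hG : ∀ᶠ x in residual X, ∀ n, Dense {y | (x, y) ∈ O n} :=
    eventually_countable_forall.2 fun n => (hd n).residual_forall_dense_slice (ho n)
  -- Requiring dense slices at each point of S keeps the set extendable: if S is countable, Baire
  -- gives a compatible new point.
  obtain ⟨S, hS⟩ := zorn_subset
    {S : Set X | (∀ x ∈ S, ∀ n, Dense {y | (x, y) ∈ O n}) ∧
      S.Pairwise fun x y => ∀ n, (x, y) ∈ O n} (by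
    intro c hc hchain
    refine ⟨⋃₀ c, ⟨?_, ?_⟩, fun s hs => subset_sUnion_of_mem hs⟩
    · rintro x ⟨s, hs, hx⟩
      exact (hc hs).1 x hx
    · exact (pairwise_sUnion hchain.directedOn).2 fun s hs => (hc hs).2)
  obtain ⟨hdense, hpair⟩ := hS.prop
  refine ⟨S, fun hcount => ?_, fun x hx y hy hne => hpair hx hy hne⟩
  have h1 : ∀ᶠ y in residual X, ∀ x ∈ S, ∀ n, (x, y) ∈ O n := by
    rw [eventually_countable_ball hcount]
    exact fun x hx => eventually_countable_forall.2 fun n =>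
      residual_of_dense_open ((ho n).preimage (by fun_prop)) (hdense x hx n)
  have h2 : ∀ᶠ y in residual X, ∀ x ∈ S, y ≠ x := by
    rw [eventually_countable_ball hcount]
    exact fun x _ => residual_of_dense_open isOpen_compl_singleton (dense_compl_singleton x)
  obtain ⟨y, hyG, hy1, hy2⟩ := (dense_of_mem_residual (hG.and (h1.and h2))).nonempty
  refine hy2 y (hS.le_of_ge (y := insert y S) ⟨?_, ?_⟩ (subset_insert y S) (mem_insert y S)) rfl
  · exact forall_mem_insert.2 ⟨hyG, hdense⟩
  · exact hpair.insert fun x hx _ =>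
      ⟨fun n => hsymm n _ _ (hy1 x hx n), hy1 x hx⟩

end Residual

/-! ### Li–Yorke chaos. -/

theorem mainTheorem1 {X : Type*} [MetricSpace X] [CompactSpace X] [Nontrivial X]
    (F : NDS X) (f : C(X, X))
    (hmin : NDS.IsMinimal F)
    (hopen : NDS.IsFeeblyOpen F)
    (hsurj : ∀ n : ℕ, Function.Surjective (F n))
    (hunif : TendstoUniformly (fun (n : ℕ) (x : X) => F n x) f Filter.atTop)
    (hcoll : NDS.ConvergesCollectively F f)
    (hmulti : NDS.IsMultiTransitive F) :
    NDS.IsLiYorkeChaotic F := by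
  have : ∀ x : X, (𝓝[≠] x).NeBot := hmulti.nhdsNE_neBot hcoll
  obtain ⟨a, b, hab⟩ := exists_pair_ne X
  -- Points within δ of a and b are more than 4δ - 2δ > δ apart.
  have hδ : 0 < dist a b / 4 := by linarith [dist_pos.2 hab]
  set δ := dist a b / 4 with hδdef
  let D : ℕ → X × X → ℝ := fun n p => dist (NDS.comp F 0 n p.1) (NDS.comp F 0 n p.2)
  have hD : ∀ n, Continuous (D n) := fun n => by fun_prop
  have hDsymm : ∀ n x y, D n (x, y) = D n (y, x) := fun n x y => dist_comm _ _
  have hDle : ∀ n p, D n p ≤ Metric.diam (univ : Set X) := fun n p =>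
    Metric.dist_le_diam_of_mem isCompact_univ.isBounded (mem_univ _) (mem_univ _)
  have hnear : ∀ (c d : X) (η : ℝ) (N : ℕ) (W : Set (X × X)), 0 < η → IsOpen W → W.Nonempty →
      ∃ p ∈ W, ∃ n ≥ N, dist (NDS.comp F 0 n p.1) c < η ∧ dist (NDS.comp F 0 n p.2) d < η := by
    rintro c d η N W hη hW ⟨⟨u, v⟩, huv⟩
    obtain ⟨U, V, hU, hV, hu, hv, hUV⟩ := isOpen_prod_iff.1 hW u v huv
    obtain ⟨n, hn, x, hx, y, hy, hxc, hyd⟩ :=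
      hmulti.exists_pair_near hmin hopen hsurj hcoll hU hV ⟨u, hu⟩ ⟨v, hv⟩ c d hη N
    exact ⟨(x, y), hUV ⟨hx, hy⟩, n, hn, hxc, hyd⟩
  have hprox : ∀ N, IsOpen {p | ∃ n ≥ N, D n p < 1 / ((N : ℝ) + 1)} := fun N => by
    simp only [ofPred_exists, ofPred_and]
    exact isOpen_iUnion fun n => isOpen_const.inter (isOpen_lt (hD n) continuous_const)
  obtain ⟨S, hS, hpair⟩ := exists_uncountable_pairwise (X := X)
    (O := fun N => {p | ∃ n ≥ N, D n p < 1 / (N + 1)} ∩ {p | ∃ n ≥ N, δ < D n p})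
    (fun N => by
      refine (hprox N).inter ?_
      simp only [ofPred_exists, ofPred_and]
      exact isOpen_iUnion fun n => isOpen_const.inter (isOpen_lt continuous_const (hD n)))
    (fun N => by
      refine Dense.inter_of_isOpen_left ?_ ?_ (hprox N) <;>
        refine dense_iff_inter_open.2 fun W hW nW => ?_
      · have hN : (0 : ℝ) < 1 / (N + 1) := by positivity
        obtain ⟨p, hp, n, hn, h1, h2⟩ := hnear a a _ N W (half_pos hN) hW nW
        refine ⟨p, hp, n, hn, (dist_triangle_right _ _ a).trans_lt ?_⟩
        linarith
      · obtain ⟨p, hp, n, hn, h1, h2⟩ := hnear a b δ N W hδ hW nW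
        refine ⟨p, hp, n, hn, ?_⟩
        have h3 := dist_triangle4 a (NDS.comp F 0 n p.1) (NDS.comp F 0 n p.2) b
        rw [dist_comm a (NDS.comp F 0 n p.1)] at h3
        change δ < dist (NDS.comp F 0 n p.1) (NDS.comp F 0 n p.2)
        linarith)
    (fun N x y => by simp only [mem_inter_iff, mem_ofPred_eq, hDsymm _ x y]; exact id)
  refine ⟨S, hS, fun x hx y hy hne => ?_⟩
  have h := hpair x hx y hy hne
  have hbdd : IsBoundedUnder (· ≤ ·) atTop fun n => D n (x, y) :=
    isBoundedUnder_of ⟨_, fun n => hDle n _⟩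
  have hbdd' : IsBoundedUnder (· ≥ ·) atTop fun n => D n (x, y) :=
    isBoundedUnder_of ⟨0, fun n => dist_nonneg⟩
  constructor
  · refine le_antisymm (le_of_forall_pos_le_add fun ε hε => ?_)
      (le_liminf_of_le hbdd.isCoboundedUnder_ge (Eventually.of_forall fun n => dist_nonneg))
    refine liminf_le_of_frequently_le (frequently_atTop.2 fun N => ?_) hbdd'
    obtain ⟨M, hM⟩ := exists_nat_one_div_lt hε
    obtain ⟨n, hn, hlt⟩ := (h (max M N)).1
    refine ⟨n, (le_max_right _ _).trans hn, ?_⟩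
    have : 1 / (((max M N : ℕ) : ℝ) + 1) ≤ 1 / (M + 1) := by
      gcongr
      exact le_max_left _ _
    rw [zero_add]
    exact (hlt.trans_le this).le.trans hM.le
  · refine hδ.trans_le (le_limsup_of_frequently_le (frequently_atTop.2 fun N => ?_) hbdd)
    obtain ⟨n, hn, hlt⟩ := (h N).2
    exact ⟨n, hn, hlt.le⟩
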